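/- Let $\mathbb F_q$ be a finite field with $q$ elements, $q$ odd, let $\chi_q$ be its quadratic character ($\chi_q(0)=0$), and let $n\ge 1$ be an integer. The Chebyshev polynomials are defined by $T_0(x)=2$, $T_1(x)=x$, $T_n(x)=xT_{n-1}(x)-T_{n-2}(x)$ for $n\ge 2$, and $T_n$ is regarded as a map $\mathbb F_q\to\mathbb F_q$. Definitions. * The $n$-decomposition of a positive integer $m$ is the unique factorization $m=m_0m_1$ into positive integers such that every prime factor of $m_0$ divides $n$ and $\gcd(m_1,n)=1$. * If $b\geq 1$ is an integer all of whose prime factors divide $n$, the $\nu$-series of $b$ and $n$ is the non-increasing sequence $b(n)=(\nu_1,\dots,\nu_d)$ with $\nu_1=\gcd(b,n)$, $\nu_{i+1}=\gcd\big(\tfrac{b}{\nu_1\cdots\nu_i},n\big)$, where $d$ is the least positive integer with $\nu_1\cdots\nu_d=b$. * Let $\bullet$ be the one-vertex rooted tree and, for a forest $G$, let $\langle G\rangle$ be the rooted tree obtained by adding a new root whose predecessors are exactly the roots of the trees of $G$. Write $\oplus$ for disjoint union and $k\times T$ for the disjoint union of $k$ copies of $T$. For a non-increasing sequence of positive integers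 $V=(\nu_1,\dots,\nu_d)$, $d\ge1$, put $T_V^0=\bullet$, $$T_V^k=\Big\langle \nu_k\times T_V^{k-1}\oplus\bigoplus_{i=1}^{k-1}(\nu_i-\nu_{i+1})\times T_V^{i-1}\Big\rangle\quad(1\le k<d),$$ $$T_V=\Big\langle (\nu_d-1)\times T_V^{d-1}\oplus\bigoplus_{i=1}^{d-1}(\nu_i-\nu_{i+1})\times T_V^{i-1}\Big\rangle .$$ * For a periodic point $a$ of a map $f:X\to X$ on a finite set, the hanging tree of $a$ in the functional graph of $f$ (edges $x\to f(x)$) is the tree with root $a$ whose vertices are the $x\in X$ such that, for some $k\ge 0$, $f^{(k)}(x)=a$ and none of $x,f(x),\dots,f^{(k-1)}(x)$ is periodic, with the edges $x\to f(x)$ for the vertices $x\ne a$. Proposition. Let $q-1=a_0b_0$ and $q+1=a_1b_1$ be the $n$-decompositions of $q-1$ and $q+1$. Let $a\neq 2$ be a periodic point of $T_n:\mathbb F_q\to\mathbb F_q$ and let $T$ be the hanging tree of $a$ in the functional graph of $T_n$ over $\mathbb F_q$. Then, up to isomorphism of rooted trees, $$T\cong\begin{cases}T_{a_0(n)} & \text{if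 }\chi_q(a^2-4)=1,\\ T_{a_1(n)} & \text{if }\chi_q(a^2-4)=-1.\end{cases}$$ -/

import Mathlib

universe u v

/-- A directed graph with a distinguished vertex. Rooted trees are represented in this way,
with every edge pointing towards the root (from a vertex to its successor). -/
structure RootedDigraph : Type (u + 1) where
  /-- The vertices. -/
  Vertex : Type u
  /-- `Adj x y` means that there is an edge from `x` to `y`. -/
  Adj : Vertex → Vertex → Prop
  /-- The root. -/
  root : Vertex

namespace RootedDigraph

/-- Isomorphism of rooted directed graphs. -/
def Isomorphic (S : RootedDigraph.{u}) (T : RootedDigraph.{v}) : Prop :=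
  ∃ e : S.Vertex ≃ T.Vertex,
    e S.root = T.root ∧ ∀ x y : S.Vertex, S.Adj x y ↔ T.Adj (e x) (e y)

/-- The tree `•` with a unique vertex (and no edge). -/
def single : RootedDigraph.{u} where
  Vertex := PUnit
  Adj _ _ := False
  root := PUnit.unit

/-- The edges of `⟨⨁ i, T i⟩`: those of the trees `T i`, and one from the root of each `T i` to the
new root `none`. -/
inductive GraftAdj {ι : Type u} (T : ι → RootedDigraph.{u}) :
    Option (Σ i, (T i).Vertex) → Option (Σ i, (T i).Vertex) → Prop
  | inner (i : ι) (x y : (T i).Vertex) (h : (T i).Adj x y) :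
      GraftAdj T (some ⟨i, x⟩) (some ⟨i, y⟩)
  | toRoot (i : ι) : GraftAdj T (some ⟨i, (T i).root⟩) none

/-- The tree `⟨⨁ i, T i⟩`: a new root is added to the disjoint union of the trees `T i`, and its
predecessors are exactly the roots of the `T i`. -/
def graft {ι : Type u} (T : ι → RootedDigraph.{u}) : RootedDigraph.{u} where
  Vertex := Option (Σ i, (T i).Vertex)
  Adj := GraftAdj T
  root := none

/-- The trees `T_V^k` for a non-increasing sequence `V`, here indexed from `0`
(so `ν i` is the usual `ν_{i+1}`):
`T_V^0 = •` and `T_V^{k+1} = ⟨ν_{k+1} × T_V^k ⊕ ⨁_{1 ≤ i ≤ k} (ν_i - ν_{i+1}) × T_V^{i-1}⟩`. -/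
def levelTree (ν : ℕ → ℕ) : ℕ → RootedDigraph.{0}
  | 0 => single
  | k + 1 => graft (Sum.elim
      (fun _ : Fin (ν k) => levelTree ν k)
      (fun p : (Σ i : Fin k, Fin (ν i - ν (i + 1))) => levelTree ν p.1))
termination_by k => k
decreasing_by
  · exact Nat.lt_succ_self k
  · exact Nat.lt_succ_of_lt p.1.isLt

/-- The elementary tree `T_V` of a non-increasing sequence `V = (ν_1, …, ν_d)` of positive
integers: `T_V = ⟨(ν_d - 1) × T_V^{d-1} ⊕ ⨁_{1 ≤ i ≤ d-1} (ν_i - ν_{i+1}) × T_V^{i-1}⟩`.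
(The empty sequence, which does not occur, is given the tree `•`.) -/
def elementaryTree (V : List ℕ) : RootedDigraph.{0} :=
  let ν : ℕ → ℕ := fun i => V.getD i 1
  match V.length with
  | 0 => single
  | k + 1 => graft (Sum.elim
      (fun _ : Fin (ν k - 1) => levelTree ν k)
      (fun p : (Σ i : Fin k, Fin (ν i - ν (i + 1))) => levelTree ν p.1))

/-- The hanging tree of (the periodic point) `a` in the functional graph of `f`: its vertices are
the points `x` whose forward orbit reaches `a` with no periodic point before `a`, its edges are
`x → f x` for the vertices `x ≠ a`, and its root is `a`. -/
def hangingTree {X : Type u} (f : X → X) (a : X) : RootedDigraph.{u} where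
  Vertex := {x : X // ∃ k : ℕ, f^[k] x = a ∧ ∀ j < k, f^[j] x ∉ Function.periodicPts f}
  Adj x y := x.1 ≠ a ∧ f x.1 = y.1
  root := ⟨a, 0, rfl, fun _ hj => absurd hj (Nat.not_lt_zero _)⟩

end RootedDigraph

/-- `m = m₀ * m₁` is the `n`-decomposition of `m`: `n` lies in the radical of the ideal generated
by `m₀` (every prime factor of `m₀` divides `n`), and `m₁` is coprime to `n`. -/
structure IsNDecomposition (n m m₀ m₁ : ℕ) : Prop where
  eq_mul : m = m₀ * m₁
  dvd_pow : ∃ k : ℕ, m₀ ∣ n ^ k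
  coprime : Nat.Coprime m₁ n

/-- The product `a_1 ⋯ a_i`, where `a_{i+1} = gcd(b / (a_1 ⋯ a_i), n)`. -/
def nuProd (b n : ℕ) : ℕ → ℕ
  | 0 => 1
  | i + 1 => nuProd b n i * Nat.gcd (b / nuProd b n i) n

/-- The `ν`-series `b(n) = (a_1, …, a_d)`, where `a_{i+1} = gcd(b / (a_1 ⋯ a_i), n)` and `d` is the
least positive integer with `a_1 ⋯ a_d = b`. -/
noncomputable def nuSeries (b n : ℕ) : List ℕ :=
  (List.range (sInf {d : ℕ | 0 < d ∧ nuProd b n d = b})).map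
    fun i => Nat.gcd (b / nuProd b n i) n

/-! ### Isomorphisms of rooted digraphs and grafting. -/

namespace RootedDigraph

universe w

/-! Over an algebraic closure, write `x = u + u⁻¹`; then `T_n` becomes the power map `u ↦ u ^ n`.
The points of `𝔽_q` come from `u` in the cyclic groups `μ_{q-1}` and `μ_{q+1}`, and for `a = t +
t⁻¹` the character of `a² - 4 = (t - t⁻¹)²` tells which group contains `t`. The map `u ↦ u + u⁻¹`
identifies `u` with `u⁻¹`, but since `t ≠ t⁻¹` it is injective on the hanging tree of `t`, hence an
isomorphism onto that of `a` (`hangingTree_chebyshev_isomorphic`).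

It remains to treat the power map on a cyclic group of order `b * c`, with `b` dividing a power of
`n` and `c` prime to `n`. A point in the range of the `(i+1)`-st iterate has as many preimages in
the range of the `i`-th as there are `n`-torsion elements among the `n ^ i`-th powers, namely `gcd(b
/ (ν_1 ⋯ ν_i), n) = ν_{i+1}` (`ncard_pow_predecessors`).

Such uniform counts determine the hanging trees of any finite system. Call level of a non-periodic
point the largest `j` with the point in the range of `f^[j]`. Subtracting consecutive counts gives
the number of predecessors of each level, and this is the recursion defining `T_V^k` and `T_V`
(`hangingTree_isomorphic_elementaryTree`). -/

theorem Isomorphic.symm {S : RootedDigraph.{u}} {T : RootedDigraph.{v}} (h : Isomorphic S T) :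
    Isomorphic T S := by
  obtain ⟨e, hr, ha⟩ := h
  exact ⟨e.symm, by rw [← hr, e.symm_apply_apply], fun x y => by simp [ha]⟩

theorem Isomorphic.trans {S : RootedDigraph.{u}} {T : RootedDigraph.{v}} {U : RootedDigraph.{w}}
    (h : Isomorphic S T) (h' : Isomorphic T U) : Isomorphic S U := by
  obtain ⟨e, hr, ha⟩ := h
  obtain ⟨e', hr', ha'⟩ := h'
  exact ⟨e.trans e', by simp [hr, hr'], fun x y => by simp [ha, ha']⟩

theorem graftAdj_some_some {ι : Type u} {T : ι → RootedDigraph.{u}} {i j : ι} {x : (T i).Vertex}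
    {y : (T j).Vertex} :
    GraftAdj T (some ⟨i, x⟩) (some ⟨j, y⟩) ↔ ∃ h : i = j, (T j).Adj (h ▸ x) y := by
  constructor
  · rintro (_ | _)
    exact ⟨rfl, by assumption⟩
  · rintro ⟨rfl, h⟩
    exact .inner _ _ _ h

theorem graftAdj_some_none {ι : Type u} {T : ι → RootedDigraph.{u}} {i : ι} {x : (T i).Vertex} :
    GraftAdj T (some ⟨i, x⟩) none ↔ x = (T i).root := by
  constructor
  · rintro (_ | _)
    rfl
  · rintro rfl
    exact .toRoot i

theorem not_graftAdj_none {ι : Type u} {T : ι → RootedDigraph.{u}}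
    {y : Option (Σ i, (T i).Vertex)} : ¬ GraftAdj T none y := by
  rintro (_ | _)

theorem graft_isomorphic_graft {ι : Type u} {κ : Type v} {S : ι → RootedDigraph.{u}}
    {T : κ → RootedDigraph.{v}} (e : ι ≃ κ) (h : ∀ i, Isomorphic (S i) (T (e i))) :
    Isomorphic (graft S) (graft T) := by
  choose ε hr ha using h
  refine ⟨Equiv.optionCongr (Equiv.sigmaCongr e ε), rfl, ?_⟩
  rintro (_ | ⟨i, x⟩) (_ | ⟨j, y⟩)
  · exact iff_of_false not_graftAdj_none not_graftAdj_none
  · exact iff_of_false not_graftAdj_none not_graftAdj_none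
  · refine graftAdj_some_none.trans (Iff.trans ?_ graftAdj_some_none.symm)
    exact (ε i).apply_eq_iff_eq.symm.trans (by rw [hr i]; rfl)
  · refine graftAdj_some_some.trans (Iff.trans ?_ graftAdj_some_some.symm)
    constructor
    · rintro ⟨rfl, h⟩
      exact ⟨rfl, (ha _ _ _).1 h⟩
    · rintro ⟨hij, h⟩
      obtain rfl := e.injective hij
      exact ⟨rfl, (ha _ _ _).2 h⟩

theorem graft_isomorphic_single {ι : Type u} [IsEmpty ι] (S : ι → RootedDigraph.{u}) :
    Isomorphic (graft S) single.{v} := by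
  refine ⟨⟨fun _ => PUnit.unit, fun _ => none, ?_, fun _ => rfl⟩, rfl, ?_⟩
  · rintro (_ | s)
    · rfl
    · exact isEmptyElim s.1
  · rintro (_ | s) y
    · exact iff_of_false not_graftAdj_none not_false
    · exact isEmptyElim s.1

end RootedDigraph

/-! ### Hanging trees as grafts over non-periodic predecessors. -/

section Dynamics

open Function RootedDigraph

variable {X : Type u} {f : X → X}

theorem iterate_mem_periodicPts {x : X} (hx : x ∈ periodicPts f) (k : ℕ) :
    f^[k] x ∈ periodicPts f := by
  obtain ⟨p, hp, h⟩ := hx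
  exact ⟨p, hp, h.apply_iterate k⟩

theorem mem_range_iterate_of_mem_periodicPts {x : X} (hx : x ∈ periodicPts f) (k : ℕ) :
    x ∈ Set.range f^[k] := by
  obtain ⟨p, hp, h⟩ := hx
  refine ⟨f^[p * k - k] x, ?_⟩
  rw [← iterate_add_apply, Nat.add_sub_cancel' (Nat.le_mul_of_pos_left k hp)]
  exact h.mul_const k

theorem range_iterate_antitone (f : X → X) : Antitone fun k => Set.range f^[k] := by
  refine antitone_nat_of_succ_le fun k => ?_
  rintro _ ⟨z, rfl⟩
  exact ⟨f z, rfl⟩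

theorem mem_periodicPts_of_iterate_apply {x y : X} {k : ℕ} (hy : f y = x) (h : f^[k] x = y) :
    y ∈ periodicPts f :=
  ⟨k + 1, k.succ_pos, by rw [IsPeriodicPt, IsFixedPt, iterate_succ_apply, hy, h]⟩

/-- An orbit meeting both `y` and `y'` at different times would run from `x` back to the later one,
making it periodic. This makes the branches of a hanging tree disjoint. -/
theorem predecessor_unique {x y y' z : X} {k k' : ℕ} (hy : f y = x) (hy' : f y' = x)
    (hz : f^[k] z = y) (hz' : f^[k'] z = y') (hp : y ∉ periodicPts f) (hp' : y' ∉ periodicPts f) :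
    y = y' := by
  wlog hle : k ≤ k' generalizing y y' k k'
  · exact (this hy' hy hz' hz hp' hp (le_of_not_ge hle)).symm
  obtain ⟨d, rfl⟩ := Nat.exists_eq_add_of_le' hle
  rw [iterate_add_apply, hz] at hz'
  cases d with
  | zero => exact hz'
  | succ e =>
    rw [iterate_succ_apply, hy] at hz'
    exact absurd (mem_periodicPts_of_iterate_apply hy' hz') hp'

/-- The hanging tree of `x` is obtained by grafting the hanging trees of its non-periodic
predecessors. -/
theorem graft_isomorphic_hangingTree (f : X → X) (x : X) :
    Isomorphic (graft fun y : {y : X // f y = x ∧ y ∉ periodicPts f} => hangingTree f y.1)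
      (hangingTree f x) := by
  have hmem : ∀ (y : {y : X // f y = x ∧ y ∉ periodicPts f}) (z : (hangingTree f y.1).Vertex),
      ∃ k : ℕ, f^[k] z.1 = x ∧ ∀ j < k, f^[j] z.1 ∉ periodicPts f := by
    rintro ⟨y, hy, hp⟩ ⟨z, k, hk, hj⟩
    refine ⟨k + 1, by rw [iterate_succ_apply', hk, hy], fun j hjk => ?_⟩
    rcases Nat.lt_succ_iff_lt_or_eq.1 hjk with h | rfl
    · exact hj j h
    · simpa [hk] using hp
  let F : (graft fun y : {y : X // f y = x ∧ y ∉ periodicPts f} => hangingTree f y.1).Vertex →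
      (hangingTree f x).Vertex := fun u => match u with
    | none => (hangingTree f x).root
    | some ⟨y, z⟩ => ⟨z.1, hmem y z⟩
  have hne : ∀ (y : {y : X // f y = x ∧ y ∉ periodicPts f}) (z : (hangingTree f y.1).Vertex),
      z.1 ≠ x := by
    rintro ⟨y, hy, hp⟩ ⟨z, k, hk, hj⟩ (h : z = x)
    rw [h] at hk
    exact hp (mem_periodicPts_of_iterate_apply hy hk)
  have hF : Bijective F := by
    constructor
    · rintro (_ | ⟨y, z⟩) (_ | ⟨y', z'⟩) h
      · rfl
      · exact absurd (congrArg Subtype.val h).symm (hne y' z')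
      · exact absurd (congrArg Subtype.val h) (hne y z)
      · have h : z.1 = z'.1 := congrArg Subtype.val h
        obtain ⟨y, hy, hp⟩ := y
        obtain ⟨y', hy', hp'⟩ := y'
        obtain ⟨z, k, hk, hj⟩ := z
        obtain ⟨z', k', hk', hj'⟩ := z'
        obtain rfl : z = z' := h
        obtain rfl := predecessor_unique hy hy' hk hk' hp hp'
        rfl
    · rintro ⟨z, k, hk, hj⟩
      cases k with
      | zero => exact ⟨none, Subtype.ext hk.symm⟩
      | succ k =>
        refine ⟨some ⟨⟨f^[k] z, by rw [← hk, iterate_succ_apply'], hj k k.lt_succ_self⟩,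
          ⟨z, k, rfl, fun j h => hj j (h.trans k.lt_succ_self)⟩⟩, rfl⟩
  refine ⟨Equiv.ofBijective F hF, rfl, ?_⟩
  rintro (_ | ⟨y, z⟩) v
  · exact iff_of_false not_graftAdj_none fun h => h.1 rfl
  obtain _ | ⟨y', z'⟩ := v
  · refine graftAdj_some_none.trans ⟨?_, ?_⟩
    · rintro rfl
      exact ⟨hne _ _, y.2.1⟩
    · rintro ⟨-, h⟩
      obtain ⟨z, k, hk, hj⟩ := z
      cases k with
      | zero => exact Subtype.ext hk
      | succ k =>
        have h : f z = x := h
        rw [iterate_succ_apply, h] at hk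
        exact absurd (mem_periodicPts_of_iterate_apply y.2.1 hk) y.2.2
  · refine graftAdj_some_some.trans ⟨?_, ?_⟩
    · rintro ⟨rfl, h⟩
      exact ⟨hne _ _, h.2⟩
    · rintro ⟨-, h⟩
      have h : f z.1 = z'.1 := h
      obtain ⟨y, hy, hp⟩ := y
      obtain ⟨y', hy', hp'⟩ := y'
      obtain ⟨z, k, hk, hj⟩ := z
      obtain ⟨z', k', hk', hj'⟩ := z'
      -- The orbit of `z` meets `y` after `k` steps and `y'` after `k' + 1` steps, through `z'`.
      obtain rfl := predecessor_unique (k' := k' + 1) hy hy' hk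
        (by rw [iterate_succ_apply]; simpa [h] using hk') hp hp'
      refine ⟨rfl, fun hzy : z = y => ?_, h⟩
      obtain rfl : x = z' := by rw [← hy, ← hzy]; exact h
      exact hp (mem_periodicPts_of_iterate_apply hy hk')

end Dynamics

/-! ### Uniform predecessor counts determine the hanging trees. -/

open Function RootedDigraph

theorem exists_equiv_of_card_fiber_eq {ι : Type u} {κ : Type v} [Finite ι] [Finite κ]
    (c : ι → ℕ) (d : κ → ℕ) (h : ∀ j, Nat.card {i // c i = j} = Nat.card {i // d i = j}) :
    ∃ e : ι ≃ κ, ∀ i, d (e i) = c i := by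
  have ε := fun j => (Finite.card_eq.1 (h j)).some
  refine ⟨((Equiv.sigmaFiberEquiv c).symm.trans (Equiv.sigmaCongrRight ε)).trans
    (Equiv.sigmaFiberEquiv d), fun i => ?_⟩
  exact (ε (c i) ⟨i, rfl⟩).2

/-- The index type of the trees grafted in `levelTree` and `elementaryTree` has `m` elements of
level `k` and `ν i - ν (i + 1)` elements of each level `i < k`. -/
theorem card_level_eq (ν : ℕ → ℕ) (m k j : ℕ) :
    Nat.card {s : Fin m ⊕ (Σ i : Fin k, Fin (ν i - ν (i + 1))) //
      Sum.elim (fun _ => k) (fun p => (p.1 : ℕ)) s = j} =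
      if j = k then m else if j < k then ν j - ν (j + 1) else 0 := by
  rw [Nat.card_congr (Equiv.subtypeSum (p := fun s : Fin m ⊕ (Σ i : Fin k, Fin (ν i - ν (i + 1))) =>
    Sum.elim (fun _ => k) (fun p => (p.1 : ℕ)) s = j)), Nat.card_sum]
  simp only [Sum.elim_inl, Sum.elim_inr]
  have h₁ : Nat.card {_a : Fin m // k = j} = if j = k then m else 0 := by
    split_ifs with h
    · simp [h]
    · have : IsEmpty {_a : Fin m // k = j} := ⟨fun x => h x.2.symm⟩
      simp
  have h₂ : Nat.card {p : (Σ i : Fin k, Fin (ν i - ν (i + 1))) // (p.1 : ℕ) = j} =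
      if j < k then ν j - ν (j + 1) else 0 := by
    split_ifs with h
    · rw [← Nat.card_fin (ν j - ν (j + 1))]
      have e := Equiv.sigmaSubtype (β := fun i : Fin k => Fin (ν i - ν (i + 1))) ⟨j, h⟩
      refine Nat.card_congr (Equiv.trans (Equiv.subtypeEquivRight fun p => ?_) e)
      exact (Fin.ext_iff (a := p.1) (b := ⟨j, h⟩)).symm
    · have : IsEmpty {p : (Σ i : Fin k, Fin (ν i - ν (i + 1))) // (p.1 : ℕ) = j} :=
        ⟨fun x => h (x.2 ▸ x.1.1.2)⟩
      simp
  rw [h₁, h₂]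
  split_ifs <;> omega

section

variable {X : Type u} [Finite X] {f : X → X} {ν : ℕ → ℕ}

/-- Difference of two nested counts; `x` must lie in the range of `f^[j + 2]` for the second one to
be available. -/
theorem card_predecessors_of_level
    (hν : ∀ x i, x ∈ Set.range f^[i + 1] → {y | f y = x ∧ y ∈ Set.range f^[i]}.ncard = ν i)
    {x : X} {j : ℕ} (hx : x ∈ Set.range f^[j + 2]) :
    {y | f y = x ∧ y ∈ Set.range f^[j] ∧ y ∉ Set.range f^[j + 1]}.ncard = ν j - ν (j + 1) := by
  rw [← hν x j (range_iterate_antitone f (Nat.le_succ _) hx), ← hν x (j + 1) hx,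
    ← Set.ncard_sdiff]
  · congr 1
    ext y
    simp only [Set.mem_ofPred_eq, Set.mem_sdiff]
    tauto
  · exact fun y hy => ⟨hy.1, range_iterate_antitone f (Nat.le_succ _) hy.2⟩

/-- If the numbers of non-periodic predecessors of `x` of each level are `m` for the level `k` and
`ν i - ν (i + 1)` for `i < k`, the hanging tree of `x` is the corresponding graft. -/
theorem hangingTree_isomorphic_graft {x : X} {m k : ℕ}
    (hT : ∀ j ≤ k, ∀ y, y ∈ Set.range f^[j] → y ∉ Set.range f^[j + 1] →
      Isomorphic (hangingTree f y) (levelTree ν j))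
    (hlt : ∀ j < k, {y | (f y = x ∧ y ∉ periodicPts f) ∧
      y ∈ Set.range f^[j] ∧ y ∉ Set.range f^[j + 1]}.ncard = ν j - ν (j + 1))
    (heq : {y | (f y = x ∧ y ∉ periodicPts f) ∧
      y ∈ Set.range f^[k] ∧ y ∉ Set.range f^[k + 1]}.ncard = m)
    (hgt : ∀ y, f y = x → y ∉ periodicPts f → y ∉ Set.range f^[k + 1]) :
    Isomorphic (hangingTree f x) (graft (Sum.elim (fun _ : Fin m => levelTree ν k)
      (fun p : (Σ i : Fin k, Fin (ν i - ν (i + 1))) => levelTree ν p.1))) := by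
  classical
  let P := {y : X // f y = x ∧ y ∉ periodicPts f}
  have hex : ∀ y : P, ∃ j, y.1 ∉ Set.range f^[j + 1] := fun y => ⟨k, hgt y.1 y.2.1 y.2.2⟩
  -- The level of `y`, found as the first `j` for which membership fails at `j + 1`. Only the number
  -- of predecessors of each level matters afterwards.
  let c : P → ℕ := fun y => Nat.find (hex y)
  have hcs : ∀ y : P, y.1 ∉ Set.range f^[c y + 1] := fun y => Nat.find_spec (hex y)
  have hck : ∀ y : P, c y ≤ k := fun y => Nat.find_min' (hex y) (hgt y.1 y.2.1 y.2.2)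
  have hcm : ∀ y : P, y.1 ∈ Set.range f^[c y] := fun y => by
    rcases hc : c y with _ | j
    · exact ⟨y.1, rfl⟩
    · exact not_not.1 (Nat.find_min (hex y) (show j < c y by omega))
  have hc : ∀ (y : P) j, c y = j ↔ y.1 ∈ Set.range f^[j] ∧ y.1 ∉ Set.range f^[j + 1] := by
    refine fun y j => ⟨?_, fun h => ?_⟩
    · rintro rfl
      exact ⟨hcm y, hcs y⟩
    · refine le_antisymm (Nat.find_min' (hex y) h.2) (not_lt.1 fun hlt => hcs y ?_)
      exact range_iterate_antitone f hlt h.1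
  obtain ⟨e, he⟩ := exists_equiv_of_card_fiber_eq c
    (Sum.elim (fun _ : Fin m => k)
      (fun p : (Σ i : Fin k, Fin (ν i - ν (i + 1))) => (p.1 : ℕ))) fun j => by
    have hcard : Nat.card {y : P // c y = j} = {y | (f y = x ∧ y ∉ periodicPts f) ∧
        y ∈ Set.range f^[j] ∧ y ∉ Set.range f^[j + 1]}.ncard := by
      rw [← Nat.card_coe_set_eq]
      refine Nat.card_congr ((Equiv.subtypeEquivRight fun y => hc y j).trans
        (Equiv.subtypeSubtypeEquivSubtypeInter (fun y => f y = x ∧ y ∉ periodicPts f)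
          fun y => y ∈ Set.range f^[j] ∧ y ∉ Set.range f^[j + 1]))
    rw [card_level_eq]
    split_ifs with h₁ h₂
    · rw [hcard, h₁, heq]
    · rw [hcard, hlt j h₂]
    · have : IsEmpty {y : P // c y = j} := ⟨fun y => by have := hck y.1; have := y.2; omega⟩
      simp
  refine (graft_isomorphic_hangingTree f x).symm.trans (graft_isomorphic_graft e fun y => ?_)
  have h := hT (c y) (hck y) y.1 (hcm y) (hcs y)
  rw [← he y] at h
  rcases hey : e y with a | a <;> rw [hey] at h <;> exact h

/-- A predecessor of a point of level `k + 1` cannot have level above `k`, nor be periodic; so the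
`ν k` predecessors in the range of `f^[k]` all have level exactly `k`. -/
theorem hangingTree_isomorphic_levelTree
    (hν : ∀ x i, x ∈ Set.range f^[i + 1] → {y | f y = x ∧ y ∈ Set.range f^[i]}.ncard = ν i)
    (k : ℕ) : ∀ x, x ∈ Set.range f^[k] → x ∉ Set.range f^[k + 1] →
      Isomorphic (hangingTree f x) (levelTree ν k) := by
  induction k using Nat.strong_induction_on with
  | _ k ih =>
  intro x hx hx'
  cases k with
  | zero =>
    have : IsEmpty {y : X // f y = x ∧ y ∉ periodicPts f} := ⟨fun y => hx' ⟨y.1, y.2.1⟩⟩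
    rw [levelTree]
    exact (graft_isomorphic_hangingTree f x).symm.trans (graft_isomorphic_single _)
  | succ k =>
    have hgt : ∀ y, f y = x → y ∉ Set.range f^[k + 1] := by
      rintro _ rfl ⟨z, rfl⟩
      exact hx' ⟨z, iterate_succ_apply' _ _ _⟩
    have hnp : ∀ y, f y = x → y ∉ periodicPts f := fun y hy hp =>
      hgt y hy (mem_range_iterate_of_mem_periodicPts hp _)
    rw [levelTree]
    refine hangingTree_isomorphic_graft (fun j hj => ih j (Nat.lt_succ_of_le hj)) (fun j hj => ?_) ?_
      fun y hy _ => hgt y hy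
    · rw [← card_predecessors_of_level hν
        (range_iterate_antitone f (show j + 2 ≤ k + 1 by omega) hx)]
      congr 1
      ext y
      exact ⟨fun h => ⟨h.1.1, h.2⟩, fun h => ⟨⟨h.1, hnp y h.1⟩, h.2⟩⟩
    · rw [← hν x k hx]
      congr 1
      ext y
      exact ⟨fun h => ⟨h.1.1, h.2.1⟩, fun h => ⟨⟨h.1, hnp y h.1⟩, h.2, hgt y h.1⟩⟩

/-- The hanging tree of a periodic point when the numbers `ν i` of predecessors in the range of
`f^[i]` are the same for all points of the range of `f^[i + 1]`. -/
theorem hangingTree_isomorphic_elementaryTree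
    (hν : ∀ x i, x ∈ Set.range f^[i + 1] → {y | f y = x ∧ y ∈ Set.range f^[i]}.ncard = ν i)
    {V : List ℕ} (hV : V ≠ []) (hVν : ∀ i, V.getD i 1 = ν i) {x : X} (hx : x ∈ periodicPts f) :
    Isomorphic (hangingTree f x) (elementaryTree V) := by
  obtain ⟨k, hk⟩ : ∃ k, V.length = k + 1 :=
    Nat.exists_eq_succ_of_ne_zero (mt List.length_eq_zero_iff.1 hV)
  -- The default value 1 of `getD` past the end of `V`: `x` has a single predecessor in the range of
  -- `f^[k + 1]`, the periodic one. So the others have level at most `k`, and the top count is `ν k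
  -- - 1`.
  have hone : ν (k + 1) = 1 := by
    rw [← hVν, List.getD_eq_default _ _ hk.le]
  obtain rfl : (fun i => V.getD i 1) = ν := funext hVν
  have hxr := mem_range_iterate_of_mem_periodicPts hx
  obtain ⟨w, hw, hwp⟩ : ∃ w, f w = x ∧ w ∈ periodicPts f := by
    obtain ⟨p, hp, h⟩ := hx
    refine ⟨f^[p - 1] x, ?_, iterate_mem_periodicPts ⟨p, hp, h⟩ _⟩
    rw [← iterate_succ_apply' f, Nat.succ_eq_add_one, Nat.sub_add_cancel hp]
    exact h
  have hwr := mem_range_iterate_of_mem_periodicPts hwp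
  have hgt : ∀ y, f y = x → y ∈ Set.range f^[k + 1] → y = w := fun y hy hyr => by
    obtain ⟨z, hz⟩ := Set.ncard_eq_one.1 ((hν x (k + 1) (hxr _)).trans hone)
    have h₁ : y ∈ ({z} : Set X) := hz ▸ ⟨hy, hyr⟩
    have h₂ : w ∈ ({z} : Set X) := hz ▸ ⟨hw, hwr _⟩
    rw [h₁, h₂]
  have hnp : ∀ {y j}, y ∉ Set.range f^[j] → y ∉ periodicPts f := fun h hp =>
    h (mem_range_iterate_of_mem_periodicPts hp _)
  unfold elementaryTree
  simp only [hk]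
  refine hangingTree_isomorphic_graft (fun j _ => hangingTree_isomorphic_levelTree hν j)
    (fun j hj => ?_) ?_ fun y hy hp hr => hp (hgt y hy hr ▸ hwp)
  · rw [← card_predecessors_of_level hν (hxr (j + 2))]
    congr 1
    ext y
    exact ⟨fun h => ⟨h.1.1, h.2⟩, fun h => ⟨⟨h.1, hnp h.2.2⟩, h.2⟩⟩
  · have := card_predecessors_of_level hν (hxr (k + 2))
    simp only [hone] at this
    rw [← this]
    congr 1
    ext y
    exact ⟨fun h => ⟨h.1.1, h.2⟩, fun h => ⟨⟨h.1, hnp h.2.2⟩, h.2⟩⟩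

end

/-! ### The `ν`-series. -/

section nuSeries

variable {b n : ℕ}

theorem nuProd_dvd (b n i : ℕ) : nuProd b n i ∣ b := by
  induction i with
  | zero => exact one_dvd b
  | succ i ih =>
    calc nuProd b n i * Nat.gcd (b / nuProd b n i) n
        ∣ nuProd b n i * (b / nuProd b n i) := Nat.mul_dvd_mul_left _ (Nat.gcd_dvd_left _ _)
      _ = b := Nat.mul_div_cancel' ih

theorem nuProd_pos (hb : 0 < b) (i : ℕ) : 0 < nuProd b n i :=
  Nat.pos_of_dvd_of_pos (nuProd_dvd b n i) hb

theorem nuProd_lt_nuProd_succ (hb : 0 < b) (hbn : ∃ k, b ∣ n ^ k) {i : ℕ}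
    (hi : nuProd b n i ≠ b) : nuProd b n i < nuProd b n (i + 1) := by
  obtain ⟨k, hk⟩ := hbn
  have hpos := nuProd_pos (n := n) hb i
  have hdiv : b / nuProd b n i ∣ b := Nat.div_dvd_of_dvd (nuProd_dvd b n i)
  have hg : 0 < Nat.gcd (b / nuProd b n i) n :=
    Nat.gcd_pos_of_pos_left _ (Nat.div_pos (Nat.le_of_dvd hb (nuProd_dvd b n i)) hpos)
  -- If the gcd were 1, the remaining cofactor would be prime to `n` and divide a power of `n`,
  -- hence equal 1.
  refine lt_mul_of_one_lt_right hpos (lt_of_le_of_ne hg fun h => hi ?_)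
  have h₁ : b / nuProd b n i = 1 :=
    Nat.Coprime.eq_one_of_dvd (Nat.Coprime.pow_right k h.symm) (hdiv.trans hk)
  exact Nat.eq_of_dvd_of_div_eq_one (nuProd_dvd b n i) h₁

theorem exists_nuProd_eq (hb : 0 < b) (hbn : ∃ k, b ∣ n ^ k) : ∃ d, 0 < d ∧ nuProd b n d = b := by
  by_contra! h
  have hlt : ∀ d, d < nuProd b n (d + 1) := fun d => by
    induction d with
    | zero => exact nuProd_pos hb _
    | succ d ih => exact (Nat.succ_le_of_lt ih).trans_lt (nuProd_lt_nuProd_succ hb hbn (h _ d.succ_pos))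
  exact absurd (Nat.le_of_dvd hb (nuProd_dvd b n (b + 1))) (not_le.2 (hlt b))

theorem nuProd_eq_of_le (hb : 0 < b) {d i : ℕ} (hd : nuProd b n d = b) (hi : d ≤ i) :
    nuProd b n i = b := by
  induction i, hi using Nat.le_induction with
  | base => exact hd
  | succ i _ ih => rw [nuProd, ih, Nat.div_self hb, Nat.gcd_one_left, mul_one]

theorem nuSeries_ne_nil (hb : 0 < b) (hbn : ∃ k, b ∣ n ^ k) : nuSeries b n ≠ [] := by
  have h : 0 < sInf {d : ℕ | 0 < d ∧ nuProd b n d = b} :=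
    (Nat.sInf_mem (s := {d : ℕ | 0 < d ∧ nuProd b n d = b}) (exists_nuProd_eq hb hbn)).1
  simpa [nuSeries, List.map_eq_nil_iff, List.range_eq_nil] using h.ne'

/-- Once the product has reached `b`, the gcd is `gcd(1, n) = 1`, which agrees with the default
value. -/
theorem nuSeries_getD (hb : 0 < b) (hbn : ∃ k, b ∣ n ^ k) (i : ℕ) :
    (nuSeries b n).getD i 1 = Nat.gcd (b / nuProd b n i) n := by
  have h := Nat.sInf_mem (s := {d : ℕ | 0 < d ∧ nuProd b n d = b}) (exists_nuProd_eq hb hbn)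
  by_cases hi : i < sInf {d : ℕ | 0 < d ∧ nuProd b n d = b}
  · rw [List.getD_eq_getElem _ _ (by simpa [nuSeries] using hi)]
    simp [nuSeries]
  · rw [List.getD_eq_default _ _ (by simpa [nuSeries] using hi),
      nuProd_eq_of_le hb h.2 (not_lt.1 hi), Nat.div_self hb, Nat.gcd_one_left]

end nuSeries

/-! ### Power maps on finite cyclic groups. -/

section PowerMap

variable {G : Type u} [CommGroup G]

theorem range_powMonoidHom_pow_succ (n i : ℕ) :
    (powMonoidHom (n ^ (i + 1)) : G →* G).range =
      (powMonoidHom n : (powMonoidHom (n ^ i) : G →* G).range →*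
        (powMonoidHom (n ^ i) : G →* G).range).range.map (Subgroup.subtype _) := by
  ext y
  simp only [MonoidHom.mem_range, Subgroup.mem_map, powMonoidHom_apply]
  constructor
  · rintro ⟨z, rfl⟩
    exact ⟨⟨z ^ n ^ i, z, rfl⟩ ^ n, ⟨_, rfl⟩, by simp [pow_succ, pow_mul]⟩
  · rintro ⟨_, ⟨⟨_, z, rfl⟩, rfl⟩, rfl⟩
    exact ⟨z, by simp [pow_succ, pow_mul]⟩

theorem range_pow_iterate (n i : ℕ) :
    Set.range (fun x : G => x ^ n)^[i] = (powMonoidHom (n ^ i) : G →* G).range := by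
  rw [pow_iterate]
  rfl

variable [Finite G] [IsCyclic G] {n b c : ℕ}

/-- Each further `n`-th power acts on a cyclic group and divides its order by the gcd with `n`, to
which `c` contributes nothing. -/
theorem card_range_powMonoidHom_pow (hG : Nat.card G = b * c) (hc : c.Coprime n)
    (i : ℕ) : Nat.card (powMonoidHom (n ^ i) : G →* G).range = b / nuProd b n i * c := by
  induction i with
  | zero =>
    rw [← hG.trans (by rw [nuProd, Nat.div_one] : _ = b / nuProd b n 0 * c), pow_zero]
    have : (powMonoidHom 1 : G →* G).range = ⊤ := by
      ext x
      simp
    rw [this, Subgroup.card_top]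
  | succ i ih =>
    rw [range_powMonoidHom_pow_succ, Subgroup.card_map_of_injective (Subgroup.subtype_injective _),
      IsCyclic.card_powMonoidHom_range, ih, Nat.Coprime.gcd_mul_right_cancel _ hc, nuProd,
      ← Nat.div_div_eq_div_mul, Nat.div_mul_right_comm (Nat.gcd_dvd_left _ _)]

theorem ncard_pow_predecessors (hG : Nat.card G = b * c) (hc : c.Coprime n)
    (x : G) (i : ℕ) (hx : x ∈ Set.range (fun x : G => x ^ n)^[i + 1]) :
    {y : G | y ^ n = x ∧ y ∈ Set.range (fun x : G => x ^ n)^[i]}.ncard =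
      Nat.gcd (b / nuProd b n i) n := by
  rw [range_pow_iterate] at *
  obtain ⟨z, rfl⟩ := hx
  set R := (powMonoidHom (n ^ i) : G →* G).range with hR
  have hz : z ^ n ^ i ∈ R := ⟨z, rfl⟩
  -- The fibre is the translate by `z ^ n ^ i` of the `n`-torsion of `R`.
  have hset : {y : G | y ^ n = powMonoidHom (n ^ (i + 1)) z ∧ y ∈ (R : Set G)} =
      Set.range fun k : (powMonoidHom n : R →* R).ker => ((k.1 : R) : G) * z ^ n ^ i := by
    ext y
    constructor
    · rintro ⟨hy, hyR⟩
      refine ⟨⟨⟨y, hyR⟩ * ⟨z ^ n ^ i, hz⟩⁻¹, ?_⟩, by simp⟩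
      rw [MonoidHom.mem_ker]
      refine Subtype.ext ?_
      simp [mul_pow, hy, pow_succ, pow_mul]
    · rintro ⟨⟨⟨k, hkR⟩, hk⟩, rfl⟩
      have hk : k ^ n = 1 := congrArg Subtype.val hk
      refine ⟨?_, mul_mem hkR hz⟩
      simp [mul_pow, hk, pow_succ, pow_mul]
  rw [hset, ← Nat.card_coe_set_eq, Nat.card_range_of_injective, IsCyclic.card_powMonoidHom_ker,
    hR, card_range_powMonoidHom_pow hG hc, Nat.Coprime.gcd_mul_right_cancel _ hc]
  exact fun k k' h => Subtype.ext (Subtype.ext (mul_right_cancel h))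

/-- The hanging trees of the periodic points of a power map on a finite cyclic group. -/
theorem hangingTree_pow_isomorphic (hb : IsNDecomposition n (Nat.card G) b c) {x : G}
    (hx : x ∈ periodicPts fun x : G => x ^ n) :
    Isomorphic (hangingTree (fun x : G => x ^ n) x) (elementaryTree (nuSeries b n)) := by
  have hpos : 0 < b := Nat.pos_of_ne_zero fun h => by
    have := hb.eq_mul
    rw [h, zero_mul] at this
    exact Nat.card_pos.ne' this
  exact hangingTree_isomorphic_elementaryTree (ν := fun i => Nat.gcd (b / nuProd b n i) n)
    (ncard_pow_predecessors hb.eq_mul hb.coprime) (nuSeries_ne_nil hpos hb.dvd_pow)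
    (nuSeries_getD hpos hb.dvd_pow) hx

end PowerMap

/-! ### Transport of hanging trees along a semiconjugacy. -/

/-- A semiconjugacy that is injective on the hanging tree of `b`, reflects periodicity and lifts
predecessors induces an isomorphism of hanging trees. -/
theorem hangingTree_isomorphic_of_semiconj {Y : Type u} {X : Type v} {g : Y → Y} {f : X → X}
    {p : Y → X} (hp : Semiconj p g f) {b : Y}
    (hper : ∀ s, p s ∈ periodicPts f → s ∈ periodicPts g)
    (hinj : ∀ s s' : (hangingTree g b).Vertex, p s.1 = p s'.1 → s = s')
    (hlift : ∀ j t y, g^[j] t = b → f y = p t → ∃ s, g s = t ∧ p s = y) :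
    Isomorphic (hangingTree g b) (hangingTree f (p b)) := by
  have hper' : ∀ s, p s ∈ periodicPts f ↔ s ∈ periodicPts g := fun s =>
    ⟨hper s, fun h => hp.mapsTo_periodicPts h⟩
  let F : (hangingTree g b).Vertex → (hangingTree f (p b)).Vertex := fun s => ⟨p s.1, by
    obtain ⟨s, k, hk, hj⟩ := s
    refine ⟨k, by rw [← (hp.iterate_right k).eq, hk], fun j h => ?_⟩
    rw [← (hp.iterate_right j).eq, hper']
    exact hj j h⟩
  have hF : Bijective F := by
    refine ⟨fun s s' h => hinj s s' (congrArg Subtype.val h), ?_⟩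
    -- Surjectivity: lift the orbit of `y` backwards from the root, one predecessor at a time.
    have key : ∀ k y, f^[k] y = p b → ∃ s, g^[k] s = b ∧ p s = y := by
      intro k
      induction k with
      | zero => exact fun y hy => ⟨b, rfl, hy.symm⟩
      | succ k ih =>
        intro y hy
        obtain ⟨t, ht, hty⟩ := ih (f y) hy
        obtain ⟨s, hs, hsy⟩ := hlift k t y ht hty.symm
        exact ⟨s, by rw [iterate_succ_apply, hs, ht], hsy⟩
    rintro ⟨y, k, hk, hj⟩
    obtain ⟨s, hs, rfl⟩ := key k y hk
    refine ⟨⟨s, k, hs, fun j h => ?_⟩, rfl⟩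
    rw [← hper', (hp.iterate_right j).eq]
    exact hj j h
  refine ⟨Equiv.ofBijective F hF, rfl, fun s s' => ?_⟩
  show s.1 ≠ b ∧ g s.1 = s'.1 ↔ p s.1 ≠ p b ∧ f (p s.1) = p s'.1
  have hroot : p s.1 = p b ↔ s.1 = b :=
    ⟨fun h => congrArg Subtype.val (hinj s (hangingTree g b).root h), fun h => by rw [h]⟩
  rw [ne_eq, ne_eq, hroot, ← hp.eq]
  refine and_congr_right fun hs => ⟨fun h => by rw [h], fun h => ?_⟩
  obtain ⟨s, k, hk, hj⟩ := s
  cases k with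
  | zero => exact absurd hk hs
  | succ k => exact congrArg Subtype.val (hinj ⟨g s, k, hk, fun j h => hj (j + 1) (by omega)⟩ s' h)

/-! ### The parametrization `x = u + u⁻¹` over a finite field. -/

theorem pow_eq_self_iff_pow_sub_one {G : Type u} [Group G] {u : G} {q : ℕ} (hq : 0 < q) :
    u ^ q = u ↔ u ^ (q - 1) = 1 := by
  obtain ⟨k, rfl⟩ := Nat.exists_eq_add_of_lt hq
  rw [zero_add, pow_succ, mul_eq_right, Nat.add_sub_cancel]

theorem pow_eq_inv_iff_pow_add_one {G : Type u} [Group G] {u : G} {q : ℕ} :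
    u ^ q = u⁻¹ ↔ u ^ (q + 1) = 1 := by
  rw [pow_succ, mul_eq_one_iff_eq_inv]

theorem two_ne_zero_of_ringChar_ne_two {F : Type u} [Field F] {K : Type v} [Field K]
    [Algebra F K] (hF : ringChar F ≠ 2) : (2 : K) ≠ 0 := by
  have := (map_ne_zero (algebraMap F K)).2 (Ring.two_ne_zero hF)
  rwa [map_ofNat] at this

section Field

variable {F : Type u} [Field F] [Fintype F] {K : Type v} [Field K] [Algebra F K]

/-- The images of the `q` elements of `F` already exhaust the at most `q` roots of `X ^ q - X`. -/
theorem mem_range_algebraMap_of_pow_card_eq {z : K} (hz : z ^ Fintype.card F = z) :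
    z ∈ Set.range (algebraMap F K) := by
  classical
  have hne := FiniteField.X_pow_card_sub_X_ne_zero K (Fintype.one_lt_card (α := F))
  let P : Polynomial K := Polynomial.X ^ Fintype.card F - Polynomial.X
  have hroot : ∀ w : K, w ∈ P.roots.toFinset ↔ w ^ Fintype.card F = w := fun w => by
    rw [Multiset.mem_toFinset, Polynomial.mem_roots hne]
    simp [sub_eq_zero]
  have hsub : Finset.univ.image (algebraMap F K) ⊆ P.roots.toFinset := by
    intro w hw
    obtain ⟨v, -, rfl⟩ := Finset.mem_image.1 hw
    rw [hroot, ← map_pow, FiniteField.pow_card]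
  have heq := Finset.eq_of_subset_of_card_le hsub (by
    rw [Finset.card_image_of_injective _ (algebraMap F K).injective, Finset.card_univ]
    refine (Multiset.toFinset_card_le _).trans ((Polynomial.card_roots' P).trans ?_)
    exact (FiniteField.X_pow_card_sub_X_natDegree_eq K (Fintype.one_lt_card (α := F))).le)
  obtain ⟨v, -, hv⟩ := Finset.mem_image.1 (heq ▸ (hroot z).2 hz)
  exact ⟨v, hv⟩

theorem add_inv_eq_add_inv_iff {u v : Kˣ} :
    (u + (u⁻¹ : Kˣ) : K) = v + (v⁻¹ : Kˣ) ↔ u = v ∨ u = v⁻¹ := by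
  constructor
  · intro h
    -- The difference of the two traces, multiplied by `u * v`.
    have h₁ : ((u : K) - v) * (u * v - 1) = 0 := by
      have hu : (u : K) * (u⁻¹ : Kˣ) = 1 := u.mul_inv
      have hv : (v : K) * (v⁻¹ : Kˣ) = 1 := v.mul_inv
      linear_combination (u * v : K) * h - v * hu + u * hv
    rcases mul_eq_zero.1 h₁ with h | h
    · exact .inl (Units.ext (sub_eq_zero.1 h))
    · exact .inr (eq_inv_of_mul_eq_one_left (Units.ext (by simpa using sub_eq_zero.1 h)))
  · rintro (rfl | rfl)
    · rfl
    · rw [inv_inv, add_comm]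

theorem chebyshev_C_eval_add_inv (n : ℕ) (u : Kˣ) :
    (Polynomial.Chebyshev.C K n).eval (u + (u⁻¹ : Kˣ) : K) = (u ^ n : Kˣ) + ((u ^ n)⁻¹ : Kˣ) := by
  rw [← Polynomial.dickson_one_one_eq_chebyshev_C,
    Polynomial.dickson_one_one_eval_add_inv _ _ u.mul_inv, ← inv_pow]
  simp

theorem add_inv_pow_card (u : Kˣ) :
    (u + (u⁻¹ : Kˣ) : K) ^ Fintype.card F =
      (u ^ Fintype.card F : Kˣ) + ((u ^ Fintype.card F)⁻¹ : Kˣ) := by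
  have h := map_add (FiniteField.frobeniusAlgHom F K) (u : K) (u⁻¹ : Kˣ)
  simp only [FiniteField.frobeniusAlgHom_apply] at h
  rw [h, ← inv_pow]
  simp

variable (F) in
/-- `u + u⁻¹` lies in the field with `q` elements if and only if `u ^ (q - 1) = 1` or
`u ^ (q + 1) = 1`. -/
theorem add_inv_mem_range_iff (u : Kˣ) :
    (u + (u⁻¹ : Kˣ) : K) ∈ Set.range (algebraMap F K) ↔
      u ^ (Fintype.card F - 1) = 1 ∨ u ^ (Fintype.card F + 1) = 1 := by
  rw [← pow_eq_self_iff_pow_sub_one Fintype.card_pos, ← pow_eq_inv_iff_pow_add_one, ← add_inv_eq_add_inv_iff, ← add_inv_pow_card]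
  refine ⟨?_, mem_range_algebraMap_of_pow_card_eq⟩
  rintro ⟨y, hy⟩
  rw [← hy, ← map_pow, FiniteField.pow_card]

/-- `u` is a root of `X² - yX + 1`, given by the quadratic formula; the other root is `u⁻¹`. -/
theorem exists_add_inv_eq [IsAlgClosed K] (h2 : (2 : K) ≠ 0) (y : K) :
    ∃ u : Kˣ, (u + (u⁻¹ : Kˣ) : K) = y := by
  obtain ⟨w, hw⟩ := IsAlgClosed.exists_eq_mul_self (y ^ 2 - 4)
  have h : (y + w) / 2 * ((y - w) / 2) = 1 := by
    field_simp
    linear_combination hw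
  refine ⟨⟨(y + w) / 2, (y - w) / 2, h, by rw [mul_comm, h]⟩, ?_⟩
  show (y + w) / 2 + (y - w) / 2 = y
  field_simp
  ring

theorem isSquare_of_add_inv_eq {y : F} {u : Kˣ} (hu : (u + (u⁻¹ : Kˣ) : K) = algebraMap F K y)
    (h : u ^ (Fintype.card F - 1) = 1) : IsSquare (y ^ 2 - 4) := by
  have h' : (u : K) ^ Fintype.card F = u := by
    simpa using congrArg (fun v : Kˣ => (v : K)) ((pow_eq_self_iff_pow_sub_one Fintype.card_pos).2 h)
  obtain ⟨v, hv⟩ := mem_range_algebraMap_of_pow_card_eq h'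
  -- In `K` this is `u - u⁻¹`, whose square is `y² - 4`.
  refine ⟨2 * v - y, (algebraMap F K).injective ?_⟩
  simp only [map_sub, map_mul, map_pow, map_ofNat, hv, ← hu]
  have := u.mul_inv
  linear_combination 4 * this

theorem pow_card_sub_one_of_isSquare (hF : ringChar F ≠ 2) {y : F} {u : Kˣ}
    (hu : (u + (u⁻¹ : Kˣ) : K) = algebraMap F K y) (h : IsSquare (y ^ 2 - 4)) :
    u ^ (Fintype.card F - 1) = 1 := by
  obtain ⟨w, hw⟩ := h
  have h2 : (2 : F) ≠ 0 := Ring.two_ne_zero hF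
  have h2K : (2 : K) ≠ 0 := two_ne_zero_of_ringChar_ne_two hF
  have hw' := congrArg (algebraMap F K) hw
  simp only [map_sub, map_mul, map_pow, map_ofNat] at hw'
  have hmem : ∃ v : F, algebraMap F K v = u := by
    have hinv := u.mul_inv
    -- `(2u - y)² = w²`, so `u` is `(y ± w) / 2` and lies in `F`.
    have hprod : (2 * (u : K) - algebraMap F K y - algebraMap F K w) *
        (2 * u - algebraMap F K y + algebraMap F K w) = 0 := by
      linear_combination hw' - 4 * hinv + 4 * (u : K) * hu
    rcases mul_eq_zero.1 hprod with h | h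
    · refine ⟨(y + w) / 2, ?_⟩
      simp only [map_div₀, map_add, map_ofNat]
      field_simp
      linear_combination -h
    · refine ⟨(y - w) / 2, ?_⟩
      simp only [map_div₀, map_sub, map_ofNat]
      field_simp
      linear_combination -h
  obtain ⟨v, hv⟩ := hmem
  rw [← pow_eq_self_iff_pow_sub_one Fintype.card_pos]
  refine Units.ext ?_
  rw [Units.val_pow_eq_pow_val, ← hv, ← map_pow, FiniteField.pow_card]

end Field

/-! ### From power maps to Chebyshev polynomials. -/

section Chebyshev

variable {F : Type u} [Field F] [Fintype F] {K : Type v} [Field K] [Algebra F K] [IsAlgClosed K]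

/-- Hanging trees of `T_n` at the traces `t + t⁻¹`, where `t ≠ t⁻¹` is an `m`-th root of unity and
`m = q - 1` or `m = q + 1`. -/
theorem hangingTree_chebyshev_isomorphic (hF : ringChar F ≠ 2) {m m' n b c : ℕ}
    (hm : m = Fintype.card F - 1 ∧ m' = Fintype.card F + 1 ∨
      m = Fintype.card F + 1 ∧ m' = Fintype.card F - 1)
    (hdec : IsNDecomposition n m b c) {a : F}
    (ha : a ∈ periodicPts fun x : F => (Polynomial.Chebyshev.C F n).eval x)
    {t : Kˣ} (htm : t ^ m = 1) (ht : t ≠ t⁻¹)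
    (hta : (t + (t⁻¹ : Kˣ) : K) = algebraMap F K a) :
    Isomorphic (hangingTree (fun x : F => (Polynomial.Chebyshev.C F n).eval x) a)
      (elementaryTree (nuSeries b n)) := by
  have hcard : 1 < Fintype.card F := Fintype.one_lt_card
  have hmem : ∀ u : Kˣ, (u + (u⁻¹ : Kˣ) : K) ∈ Set.range (algebraMap F K) ↔
      u ^ m = 1 ∨ u ^ m' = 1 := fun u => by
    rw [add_inv_mem_range_iff F]
    rcases hm with ⟨rfl, rfl⟩ | ⟨rfl, rfl⟩
    · rfl
    · exact or_comm
  have hinv : ∀ u : Kˣ, u ^ m = 1 → u ^ m' = 1 → u = u⁻¹ := fun u h h' => by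
    have h₁ : u ^ (Fintype.card F - 1) = 1 ∧ u ^ (Fintype.card F + 1) = 1 := by
      rcases hm with ⟨rfl, rfl⟩ | ⟨rfl, rfl⟩
      exacts [⟨h, h'⟩, ⟨h', h⟩]
    rw [← pow_eq_self_iff_pow_sub_one Fintype.card_pos, ← pow_eq_inv_iff_pow_add_one] at h₁
    exact h₁.1.symm.trans h₁.2
  -- Since `q = 0` in `K`, `m` is `-1` or `1` there; hence `μ_m` has full order `m`.
  have hm0 : NeZero (m : K) := by
    have h0 : (Fintype.card F : K) = 0 := by
      rw [← map_natCast (algebraMap F K), FiniteField.cast_card_eq_zero, map_zero]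
    refine ⟨?_⟩
    rcases hm with ⟨rfl, -⟩ | ⟨rfl, -⟩
    · rw [Nat.cast_sub hcard.le, h0]
      simp
    · rw [Nat.cast_add, h0]
      simp
  have : NeZero m := ⟨by omega⟩
  let G := rootsOfUnity m K
  have hcyc : IsCyclic G := rootsOfUnity.isCyclic K m
  choose p hp using fun u : G => (hmem u.1).2 (.inl ((mem_rootsOfUnity m _).1 u.2))
  have hp_eq : ∀ u v : G, p u = p v ↔ u = v ∨ u = v⁻¹ := fun u v => by
    rw [← (algebraMap F K).injective.eq_iff, hp, hp, add_inv_eq_add_inv_iff, Subtype.ext_iff,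
      Subtype.ext_iff, Subgroup.coe_inv]
  have heval : ∀ y : F, algebraMap F K ((Polynomial.Chebyshev.C F n).eval y) =
      (Polynomial.Chebyshev.C K n).eval (algebraMap F K y) := fun y => by
    rw [← Polynomial.Chebyshev.map_C (algebraMap F K), Polynomial.eval_map_apply]
  have hsemi : Semiconj p (fun u : G => u ^ n)
      fun x : F => (Polynomial.Chebyshev.C F n).eval x := fun u => by
    refine (algebraMap F K).injective ?_
    rw [heval, hp, hp, chebyshev_C_eval_add_inv]
    rfl
  have hit : ∀ (j : ℕ) (u : G), (fun u : G => u ^ n)^[j] u⁻¹ = ((fun u : G => u ^ n)^[j] u)⁻¹ :=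
    fun j u => by
      rw [pow_iterate]
      exact inv_pow u _
  have hper : ∀ s, p s ∈ periodicPts (fun x : F => (Polynomial.Chebyshev.C F n).eval x) →
      s ∈ periodicPts fun u : G => u ^ n := by
    rintro s ⟨k, hk, h⟩
    have h : p ((fun u : G => u ^ n)^[k] s) = p s := by
      rw [(hsemi.iterate_right k).eq]
      exact h
    -- When `p s` returns at time `k`, `s` has become `s` or `s⁻¹`; a second round removes the
    -- inversion.
    refine ⟨k + k, by omega, ?_⟩
    rw [IsPeriodicPt, IsFixedPt, iterate_add_apply]
    rcases (hp_eq _ _).1 h with h | h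
    · rw [h, h]
    · rw [h, hit, h, inv_inv]
  let t' : G := ⟨t, (mem_rootsOfUnity m t).2 htm⟩
  have ht' : t' ≠ t'⁻¹ := fun h => ht (congrArg Subtype.val h)
  have hpt : p t' = a := (algebraMap F K).injective ((hp t').trans hta)
  have htper : t' ∈ periodicPts fun u : G => u ^ n := hper t' (hpt ▸ ha)
  have hdec' : IsNDecomposition n (Nat.card G) b c := by
    have : HasEnoughRootsOfUnity K m := inferInstance
    rwa [HasEnoughRootsOfUnity.natCard_rootsOfUnity K m]
  have hiso := hangingTree_isomorphic_of_semiconj hsemi hper (b := t') ?_ ?_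
  · rw [hpt] at hiso
    exact hiso.symm.trans (hangingTree_pow_isomorphic hdec' htper)
  -- If `s` reaches `t'` at time `k`, then `s⁻¹` reaches the periodic point `t'⁻¹` at the same time.
  -- If both lay in the tree, their depths would agree by symmetry, forcing `t' = t'⁻¹`.
  · have hlt : ∀ (s : G) (k k' : ℕ), (fun u : G => u ^ n)^[k] s = t' →
        (∀ j < k', (fun u : G => u ^ n)^[j] s⁻¹ ∉ periodicPts fun u : G => u ^ n) →
        k' ≤ k := fun s k k' h h' => not_lt.1 fun hk => h' k hk (by
      rw [hit, h]
      refine hper _ ?_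
      rw [(hp_eq _ _).2 (.inr rfl), hpt]
      exact ha)
    rintro ⟨s, k, hk, hj⟩ ⟨s', k', hk', hj'⟩ h
    rcases (hp_eq s s').1 h with hs | hs
    · exact Subtype.ext hs
    · have hs' : s' = s⁻¹ := by rw [hs, inv_inv]
      obtain rfl : k = k' := le_antisymm (hlt s' k' k hk' (hs ▸ hj)) (hlt s k k' hk (hs' ▸ hj'))
      rw [hs, hit, hk'] at hk
      exact absurd hk.symm ht'
  · intro j s y hs hy
    have hss : s ≠ s⁻¹ := fun h => ht' (by
      rw [← hs, ← hit, ← h])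
    obtain ⟨u, hu⟩ := exists_add_inv_eq (two_ne_zero_of_ringChar_ne_two hF) (algebraMap F K y)
    have hun : u ^ n = s ∨ u ^ n = (s : Kˣ)⁻¹ := by
      rw [← add_inv_eq_add_inv_iff, ← chebyshev_C_eval_add_inv, hu, ← heval, ← hp]
      exact congrArg _ hy
    -- Otherwise `u`, hence `s`, would lie in `μ_{m'}`; but `s` is in `μ_m`, and elements of both
    -- groups are their own inverses.
    have hum : u ^ m = 1 := by
      refine ((hmem u).1 ⟨y, hu.symm⟩).resolve_right fun h => hss (Subtype.ext ?_)
      refine hinv s ((mem_rootsOfUnity m _).1 s.2) ?_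
      have h₁ : (u ^ n) ^ m' = 1 := by rw [pow_right_comm, h, one_pow]
      rcases hun with h | h
      · rw [← h, h₁]
      · rwa [h, inv_pow, inv_eq_one] at h₁
    let w : G := ⟨u, (mem_rootsOfUnity m u).2 hum⟩
    have hw : p w = y := (algebraMap F K).injective ((hp w).trans hu)
    rcases hun with h | h
    · exact ⟨w, Subtype.ext h, hw⟩
    · refine ⟨w⁻¹, ?_, ((hp_eq _ _).2 (.inr rfl)).trans hw⟩
      show w⁻¹ ^ n = s
      rw [inv_pow, inv_eq_iff_eq_inv]
      exact Subtype.ext h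

end Chebyshev

theorem mainTheorem4 {F : Type*} [Field F] [Fintype F] [DecidableEq F] (hF : ringChar F ≠ 2)
    (n : ℕ) (hn : 1 ≤ n) (a₀ b₀ a₁ b₁ : ℕ)
    (h₀ : IsNDecomposition n (Fintype.card F - 1) a₀ b₀)
    (h₁ : IsNDecomposition n (Fintype.card F + 1) a₁ b₁)
    (a : F) (ha2 : a ≠ 2)
    (ha : a ∈ Function.periodicPts (fun x : F => (Polynomial.Chebyshev.C F n).eval x)) :
    (quadraticChar F (a ^ 2 - 4) = 1 →
      RootedDigraph.Isomorphic
        (RootedDigraph.hangingTree (fun x : F => (Polynomial.Chebyshev.C F n).eval x) a)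
        (RootedDigraph.elementaryTree (nuSeries a₀ n))) ∧
    (quadraticChar F (a ^ 2 - 4) = -1 →
      RootedDigraph.Isomorphic
        (RootedDigraph.hangingTree (fun x : F => (Polynomial.Chebyshev.C F n).eval x) a)
        (RootedDigraph.elementaryTree (nuSeries a₁ n))) := by
  obtain ⟨t, ht⟩ := exists_add_inv_eq
    (two_ne_zero_of_ringChar_ne_two (K := AlgebraicClosure F) hF) (algebraMap F _ a)
  -- If `t = t⁻¹` then `a = 2t` and `t² = 1`, so `a² = 4`.
  have hne : a ^ 2 - 4 ≠ 0 → t ≠ t⁻¹ := fun h h' => h <| by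
    refine (algebraMap F (AlgebraicClosure F)).injective ?_
    have hinv := t.mul_inv
    rw [← h'] at ht hinv
    simp only [map_sub, map_pow, map_ofNat, map_zero, ← ht]
    linear_combination 4 * hinv
  constructor
  · intro hχ
    have h0 : a ^ 2 - 4 ≠ 0 := fun h => by simp [h] at hχ
    exact hangingTree_chebyshev_isomorphic hF (.inl ⟨rfl, rfl⟩) h₀ ha
      (pow_card_sub_one_of_isSquare hF ht ((quadraticChar_one_iff_isSquare h0).1 hχ)) (hne h0) ht
  · intro hχ
    have h0 : a ^ 2 - 4 ≠ 0 := fun h => by simp [h] at hχ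
    exact hangingTree_chebyshev_isomorphic hF (.inr ⟨rfl, rfl⟩) h₁ ha
      (((add_inv_mem_range_iff F t).1 ⟨a, ht.symm⟩).resolve_left fun h =>
        quadraticChar_neg_one_iff_not_isSquare.1 hχ (isSquare_of_add_inv_eq ht h)) (hne h0) ht
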